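/- For $p\in[0,1]$ let $\mathcal C_p$ be the qubit erasure channel with transmission probability $p$: its input is a qubit, its output space is spanned by $|{\uparrow}\rangle,|{\downarrow}\rangle$ and an erasure flag $|E\rangle$, and $\mathcal C_p(\rho)=p\,\rho+(1-p)\,\mathrm{tr}(\rho)\,|E\rangle\langle E|$. Let $n\ge 0$ be an integer, let $\mathcal E$ (the encoder) be a quantum channel, i.e. a completely positive trace-preserving map, from one qubit to $n$ qubits, and let $\mathcal D$ (the decoder) be a quantum channel from the $n$-fold tensor power of $\mathrm{span}(|{\uparrow}\rangle,|{\downarrow}\rangle,|E\rangle)$ to $\mathrm{span}(|{\uparrow}\rangle,|{\downarrow}\rangle,|E\rangle)$. For an erasure pattern $\vec s\in\{0,1\}^n$ ($s_i=1$ if the $i$-th qubit is transmitted, $s_i=0$ if it is erased) put $$\rho_{\vec s}=(\mathcal C_{s_1}\otimes\cdots\otimes\mathcal C_{s_n})\bigl(\mathcal E(\mathbb 1/2)\bigr),\qquad F(\vec s)=1-\langle E|\,\mathcal D(\rho_{\vec s})\,|E\rangle .$$ The decoder $\mathcal D$ is called deterministic (for the encoder $\mathcal E$) if $F(\vec s)\in\{0,1\}$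 for every $\vec s\in\{0,1\}^n$, i.e. whether it outputs an erasure is determined by the erasure pattern. Theorem. Let $0\le p\le 1/2$ and $p<q\le 1$. Then $\mathcal C_p$ does not simulate $\mathcal C_q$ with deterministic decoders. That is, it is not the case that for every $\epsilon>0$ there exist $n$, an encoder $\mathcal E$ and a decoder $\mathcal D$ that is deterministic for $\mathcal E$, such that $$\mathrm{tr}\bigl|\mathcal D\bigl(\mathcal C_p^{\otimes n}(\mathcal E(\rho))\bigr)-\mathcal C_q(\rho)\bigr|\le\epsilon$$ for all density matrices $\rho$ of a qubit. -/

import Mathlib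

open scoped ComplexOrder MatrixOrder Matrix.Norms.L2Operator

/-- A (finite-dimensional) quantum channel: a completely positive, trace-preserving linear map from
matrices over the basis `a` to matrices over the basis `b`. -/
structure QuantumChannel (a b : Type) [Fintype a] [DecidableEq a] [Fintype b] [DecidableEq b]
    extends CompletelyPositiveMap (Matrix a a ℂ) (Matrix b b ℂ) where
  trace_map' : ∀ X : Matrix a a ℂ, (toLinearMap X).trace = X.trace

/-- The linear map on matrices underlying a quantum channel. -/
def QuantumChannel.lin {a b : Type} [Fintype a] [DecidableEq a] [Fintype b] [DecidableEq b]
    (Φ : QuantumChannel a b) : Matrix a a ℂ →ₗ[ℂ] Matrix b b ℂ :=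
  Φ.toLinearMap

/-- Density matrices: positive semidefinite matrices of trace one. -/
def IsDensityMatrix {a : Type} [Fintype a] (ρ : Matrix a a ℂ) : Prop :=
  ρ.PosSemidef ∧ ρ.trace = 1

/-- The trace norm `tr |X|`, where `|X|` is the positive square root of `Xᴴ * X`. -/
noncomputable def traceNorm {a : Type} [Fintype a] [DecidableEq a] (X : Matrix a a ℂ) : ℝ :=
  (CFC.abs X).trace.re

/-- The tensor product `C 0 ⊗ ⋯ ⊗ C (n - 1)` of linear maps on matrices. The basis of an `n`-fold
tensor power of the space with basis `a` is indexed by `Fin n → a`. The map is the linear map that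
sends `|i⟩⟨j|`, that is, the tensor product over `m` of `|i m⟩⟨j m|`, to the tensor product over `m`
of `C m (|i m⟩⟨j m|)`. -/
noncomputable def tensorMap {a b : Type} [Fintype a] [DecidableEq a] {n : ℕ}
    (C : Fin n → (Matrix a a ℂ →ₗ[ℂ] Matrix b b ℂ)) :
    Matrix (Fin n → a) (Fin n → a) ℂ →ₗ[ℂ] Matrix (Fin n → b) (Fin n → b) ℂ where
  toFun X := Matrix.of fun k l => ∑ i : Fin n → a, ∑ j : Fin n → a,
    X i j * ∏ m : Fin n, C m (Matrix.single (i m) (j m) 1) (k m) (l m)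
  map_add' X Y := by
    ext k l
    simp [add_mul, Finset.sum_add_distrib]
  map_smul' c X := by
    ext k l
    simp [mul_assoc, Finset.mul_sum]

/-- Basis of the qubit: `|↑⟩`, `|↓⟩`. -/
abbrev Qubit : Type := Fin 2

/-- Basis of the output space of the erasure channel: `|↑⟩`, `|↓⟩` and the erasure flag
`|E⟩ = none`. -/
abbrev QubitE : Type := Option Qubit

/-- A matrix on the qubit, regarded as a matrix on the span of `|↑⟩`, `|↓⟩`, `|E⟩`. -/
def embedQubit (X : Matrix Qubit Qubit ℂ) : Matrix QubitE QubitE ℂ :=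
  Matrix.of fun k l =>
    match k, l with
    | some i, some j => X i j
    | _, _ => 0

/-- The quantum erasure channel with transmission probability `p`, as a linear map:
`ρ ↦ p ρ + (1 - p) tr(ρ) |E⟩⟨E|`. -/
noncomputable def erasureChannel (p : ℝ) :
    Matrix Qubit Qubit ℂ →ₗ[ℂ] Matrix QubitE QubitE ℂ where
  toFun X := (p : ℂ) • embedQubit X + ((1 - p : ℝ) : ℂ) • Matrix.single none none X.trace
  map_add' X Y := by
    ext (_ | k) (_ | l) <;> simp [embedQubit, Matrix.trace_add, mul_add]
  map_smul' c X := by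
    ext (_ | k) (_ | l) <;> simp [embedQubit, Matrix.trace_smul] <;> ring

/-- The encoder `E` and the decoder `D` realise an `ε`-simulation of the channel `C'` by `n` uses of
the channel `C`. -/
def IsSimulation {a b a' b' : Type} [Fintype a] [DecidableEq a] [Fintype b] [DecidableEq b]
    [Fintype a'] [DecidableEq a'] [Fintype b'] [DecidableEq b']
    (ε : ℝ) (C : Matrix a a ℂ →ₗ[ℂ] Matrix b b ℂ) (C' : Matrix a' a' ℂ →ₗ[ℂ] Matrix b' b' ℂ)
    (n : ℕ) (E : QuantumChannel a' (Fin n → a)) (D : QuantumChannel (Fin n → b) b') : Prop :=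
  ∀ ρ : Matrix a' a' ℂ, IsDensityMatrix ρ →
    traceNorm (D.lin (tensorMap (fun _ : Fin n => C) (E.lin ρ)) - C' ρ) ≤ ε

/-- The state `ρ_s` received when the maximally mixed qubit state is encoded by `E` and the erasure
pattern is `s`; `s i = true` means that the `i`-th qubit is transmitted, `s i = false` that it is
erased. -/
noncomputable def patternState {n : ℕ} (E : QuantumChannel Qubit (Fin n → Qubit))
    (s : Fin n → Bool) : Matrix (Fin n → QubitE) (Fin n → QubitE) ℂ :=
  tensorMap (fun i => erasureChannel (if s i then 1 else 0)) (E.lin ((1 / 2 : ℂ) • 1))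

/-- `F(s) = 1 - ⟨E| D(ρ_s) |E⟩`: the probability that the decoder does not output an erasure, given
the erasure pattern `s`. -/
noncomputable def nonErasureProb {n : ℕ} (E : QuantumChannel Qubit (Fin n → Qubit))
    (D : QuantumChannel (Fin n → QubitE) QubitE) (s : Fin n → Bool) : ℝ :=
  1 - (D.lin (patternState E s) none none).re

/-- The decoder `D` is deterministic (for the encoder `E`). -/
def IsDeterministicDecoder {n : ℕ} (E : QuantumChannel Qubit (Fin n → Qubit))
    (D : QuantumChannel (Fin n → QubitE) QubitE) : Prop :=
  ∀ s : Fin n → Bool, nonErasureProb E D s = 0 ∨ nonErasureProb E D s = 1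

/-! A deterministic decoder accepts a fixed set S of erasure patterns, and testing the simulation on
the erasure flag shows that S has probability within ε of q. Call an accepted pattern good if the
decoder nearly recovers the input in both the computational and the Hadamard basis. Two facts bound
the probability of S.

No cloning: the receivers of two disjoint sets of qubits perform commuting measurements, so they
cannot learn the input in two conjugate bases, one each (`half_le_error_of_commute`,
`half_le_error_of_disjoint`). Hence any two good patterns share a transmitted qubit. Such an
intersecting family has probability at most p when p ≤ 1/2 (`sum_patternProb_le_of_intersecting`):
at bias 1/2 its upward closure contains at most one of each complementary pair, and
`sum_patternProb_rpow_le` carries the bound down to bias p.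

Markov: the average error over S is O(ε) (`sum_error_le`), so bad accepted patterns have probability
O(ε). Together, q ≤ p + O(ε). -/

/-! ### Biased measures on the cube and intersecting families -/

/-- The probability of the pattern `s` when the entries are independent and each is `true` with
probability `p`. -/
def patternProb {n : ℕ} (p : ℝ) (s : Fin n → Bool) : ℝ := ∏ i, if s i then p else 1 - p

lemma patternProb_nonneg {n : ℕ} {p : ℝ} (h0 : 0 ≤ p) (h1 : p ≤ 1) (s : Fin n → Bool) :
    0 ≤ patternProb p s :=
  Finset.prod_nonneg fun i _ => by split_ifs <;> linarith

lemma sum_patternProb_mul_succ {n : ℕ} (p : ℝ) (f : (Fin (n + 1) → Bool) → ℝ) :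
    ∑ s, patternProb p s * f s =
      p * (∑ s : Fin n → Bool, patternProb p s * f (Fin.cons true s)) +
        (1 - p) * ∑ s : Fin n → Bool, patternProb p s * f (Fin.cons false s) := by
  rw [← (Fin.consEquiv (fun _ : Fin (n + 1) => Bool)).sum_comp, Fintype.sum_prod_type,
    Fintype.sum_bool, Finset.mul_sum, Finset.mul_sum]
  simp [patternProb, Fin.consEquiv, Fin.prod_univ_succ, mul_assoc]

/-- The pairs (r b, a) and (r a, v), with v the mean on the right, have the same sum, and the second
is more spread out; convexity of x ↦ x ^ t then compares the sums of t-th powers. -/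
lemma two_point_rpow_le {a b r t : ℝ} (ha : 0 ≤ a) (hab : a ≤ b) (h0 : 0 ≤ r) (h1 : r ≤ 1)
    (ht : 1 ≤ t) :
    r ^ t * b ^ t + (1 - r ^ t) * a ^ t ≤ (r * b + (1 - r) * a) ^ t := by
  have hb : 0 ≤ b := ha.trans hab
  set v := r * b + (1 - r) * a with hv
  have hra : 0 ≤ r * a := mul_nonneg h0 ha
  have hxu : r * a ≤ r * b := mul_le_mul_of_nonneg_left hab h0
  have hyu : r * a ≤ a := by nlinarith
  have hv0 : 0 ≤ v := by rw [hv]; nlinarith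
  have key : (r * b) ^ t + a ^ t ≤ (r * a) ^ t + v ^ t := by
    -- If v = r a, the interval is a point and the weight l below would divide by zero.
    rcases (show r * a ≤ v by rw [hv]; nlinarith).eq_or_lt with h | h
    · have e1 : r * b = r * a := by nlinarith
      have e2 : a = v := by nlinarith
      rw [e1, ← e2]
    · have hc := (convexOn_rpow ht).2 (Set.mem_Ici.2 hra) (Set.mem_Ici.2 hv0)
      have hd : 0 < v - r * a := sub_pos.2 h
      set l := (r * b - r * a) / (v - r * a) with hl
      have hl0 : 0 ≤ l := div_nonneg (by linarith) hd.le
      have hl1 : l ≤ 1 := by rw [hl, div_le_one hd]; linarith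
      have hlm : l * (v - r * a) = r * b - r * a := div_mul_cancel₀ _ hd.ne'
      -- r b and a are the convex combinations of r a and v with swapped weights, so the two
      -- inequalities add up to the claim.
      have i1 := hc (sub_nonneg.2 hl1) hl0 (by ring)
      have i2 := hc hl0 (sub_nonneg.2 hl1) (by ring)
      simp only [smul_eq_mul] at i1 i2
      rw [show (1 - l) * (r * a) + l * v = r * b by linarith] at i1
      rw [show l * (r * a) + (1 - l) * v = a by linarith] at i2
      linarith
  rw [Real.mul_rpow h0 hb, Real.mul_rpow h0 ha] at key
  linarith

/-- For a monotone function, the `L¹` norms with respect to the biased measures of bias `r ^ t`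
and `r` compare as if the function were an `AND` of coordinates. -/
theorem sum_patternProb_rpow_le {n : ℕ} {r t : ℝ} (h0 : 0 ≤ r) (h1 : r ≤ 1) (ht : 1 ≤ t)
    (f : (Fin n → Bool) → ℝ) (hf : Monotone f) (hf0 : ∀ s, 0 ≤ f s) :
    ∑ s, patternProb (r ^ t) s * f s ^ t ≤ (∑ s, patternProb r s * f s) ^ t := by
  induction n with
  | zero => simp [patternProb]
  | succ n ih =>
    rw [sum_patternProb_mul_succ, sum_patternProb_mul_succ]
    have hm : ∀ b : Bool, Monotone fun s : Fin n → Bool => f (Fin.cons b s) := fun b s s' h =>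
      hf (Fin.cons_le_cons.2 ⟨le_rfl, h⟩)
    have hrt1 : r ^ t ≤ 1 := Real.rpow_le_one h0 h1 (by linarith)
    refine le_trans (add_le_add
      (mul_le_mul_of_nonneg_left (ih _ (hm true) fun s => hf0 _) (Real.rpow_nonneg h0 t))
      (mul_le_mul_of_nonneg_left (ih _ (hm false) fun s => hf0 _) (sub_nonneg.2 hrt1))) ?_
    -- The two points are the conditional means of f given the first coordinate; monotonicity of f
    -- orders them.
    refine two_point_rpow_le ?_ ?_ h0 h1 ht
    · exact Finset.sum_nonneg fun s _ => mul_nonneg (patternProb_nonneg h0 h1 s) (hf0 _)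
    · exact Finset.sum_le_sum fun s _ => mul_le_mul_of_nonneg_left
        (hf (Fin.cons_le_cons.2 ⟨Bool.false_le _, le_rfl⟩)) (patternProb_nonneg h0 h1 s)

/-- The biased measure of an intersecting family is at most the bias, if the bias is at most `1/2`. -/
theorem sum_patternProb_le_of_intersecting {n : ℕ} {p : ℝ} (h0 : 0 ≤ p) (hp : p ≤ 1 / 2)
    (S : Finset (Fin n → Bool)) (hS : ∀ s ∈ S, ∀ t ∈ S, ∃ i, s i = true ∧ t i = true) :
    ∑ s ∈ S, patternProb p s ≤ p := by
  classical
  -- The exponent t below is a quotient of logarithms and needs p > 0.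
  rcases h0.eq_or_lt with rfl | hpos
  · refine Finset.sum_nonpos fun s hs => ?_
    obtain ⟨i, hi, -⟩ := hS s hs s hs
    exact (Finset.prod_eq_zero (Finset.mem_univ i) (by simp [hi])).le
  -- Indicator of the upward closure of S: monotone, and its support is still intersecting.
  set f : (Fin n → Bool) → ℝ := fun s => if ∃ u ∈ S, u ≤ s then 1 else 0 with hf
  have hf0 : ∀ s, 0 ≤ f s := fun s => by simp only [hf]; split_ifs <;> norm_num
  have hmono : Monotone f := fun s s' h => by
    simp only [hf]
    split_ifs with a b
    · rfl
    · obtain ⟨u, hu, hus⟩ := a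
      exact absurd ⟨u, hu, hus.trans h⟩ b
    · norm_num
    · rfl
  have hcompl : ∀ s, f s + f sᶜ ≤ 1 := fun s => by
    simp only [hf]
    split_ifs with a b
    · exfalso
      obtain ⟨u, hu, hus⟩ := a
      obtain ⟨v, hv, hvs⟩ := b
      obtain ⟨i, hui, hvi⟩ := hS u hu v hv
      have e1 := hus i
      have e2 := hvs i
      rw [hui] at e1
      rw [hvi, Pi.compl_apply] at e2
      revert e1 e2
      cases s i <;> simp
    all_goals norm_num
  have hhalf : ∑ s, patternProb (1 / 2) s * f s ≤ 1 / 2 := by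
    have hw : ∀ s : Fin n → Bool, patternProb (1 / 2) s = (1 / 2 : ℝ) ^ n := fun s => by
      rw [patternProb, Finset.prod_congr rfl (g := fun _ => (1 / 2 : ℝ))
        (fun i _ => by split_ifs <;> norm_num)]
      simp
    have hsum : ∑ s, f s + ∑ s, f s ≤ 2 ^ n := by
      have e : ∑ s, f sᶜ = ∑ s, f s :=
        (Equiv.mk (fun s : Fin n → Bool => sᶜ) (fun s => sᶜ) compl_compl compl_compl).sum_comp f
      nth_rw 2 [← e]
      rw [← Finset.sum_add_distrib]
      refine (Finset.sum_le_sum fun s _ => hcompl s).trans ?_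
      simp
    simp only [hw, ← Finset.mul_sum]
    have h2 : (1 / 2 : ℝ) ^ n * 2 ^ n = 1 := by rw [← mul_pow]; norm_num
    have h3 : (0 : ℝ) < (1 / 2) ^ n := by positivity
    nlinarith
  have hlog : Real.log (1 / 2) < 0 := Real.log_neg (by norm_num) (by norm_num)
  -- Chosen so that (1/2) ^ t = p; then 1 ≤ t is exactly p ≤ 1/2.
  set t := Real.log p / Real.log (1 / 2) with htdef
  have ht : 1 ≤ t := by
    rw [htdef, one_le_div_of_neg hlog]
    exact Real.log_le_log hpos hp
  have hpt : (1 / 2 : ℝ) ^ t = p := by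
    rw [Real.rpow_def_of_pos (by norm_num), htdef, mul_div_cancel₀ _ hlog.ne, Real.exp_log hpos]
  have hft : ∀ s, f s ^ t = f s := fun s => by
    simp only [hf]
    split_ifs
    · simp
    · exact Real.zero_rpow (by linarith)
  have hmain := sum_patternProb_rpow_le (r := 1 / 2) (by norm_num) (by norm_num) ht f hmono hf0
  rw [hpt] at hmain
  simp only [hft] at hmain
  calc ∑ s ∈ S, patternProb p s = ∑ s ∈ S, patternProb p s * f s :=
        Finset.sum_congr rfl fun s hs => by simp [hf, show ∃ u ∈ S, u ≤ s from ⟨s, hs, le_rfl⟩]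
    _ ≤ ∑ s, patternProb p s * f s :=
        Finset.sum_le_sum_of_subset_of_nonneg (Finset.subset_univ _) fun s _ _ =>
          mul_nonneg (patternProb_nonneg h0 (by linarith) s) (hf0 s)
    _ ≤ (∑ s, patternProb (1 / 2) s * f s) ^ t := hmain
    _ ≤ (1 / 2) ^ t := Real.rpow_le_rpow
        (Finset.sum_nonneg fun s _ => mul_nonneg
          (patternProb_nonneg (by norm_num) (by norm_num) s) (hf0 s)) hhalf (by linarith)
    _ = p := hpt

/-! ### Positive semidefinite matrices, effects and the trace norm -/

section PosSemidef

variable {N K : Type} [Fintype N] [DecidableEq N] [Fintype K] [DecidableEq K]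

lemma Matrix.PosSemidef.re_trace_mul_nonneg {A B : Matrix N N ℂ} (hA : A.PosSemidef)
    (hB : B.PosSemidef) : 0 ≤ (A * B).trace.re := by
  obtain ⟨L, hL⟩ := CStarAlgebra.nonneg_iff_eq_star_mul_self.1 hA.nonneg
  rw [hL, Matrix.mul_assoc, Matrix.trace_mul_comm, Matrix.star_eq_conjTranspose]
  exact (Complex.le_def.1 (hB.mul_mul_conjTranspose_same L).trace_nonneg).1

/-- Pairing a Hermitian matrix with an effect gives at most the trace norm. -/
lemma abs_re_trace_mul_le_traceNorm {M X : Matrix N N ℂ} (hM : M.PosSemidef)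
    (hM1 : (1 - M).PosSemidef) (hX : X.IsHermitian) : |(M * X).trace.re| ≤ traceNorm X := by
  have hsa : IsSelfAdjoint X := hX
  have h1 : (CFC.abs X - X).PosSemidef := by
    rw [← Matrix.nonneg_iff_posSemidef, CFC.abs_sub_self X hsa]
    exact nsmul_nonneg (CFC.negPart_nonneg X) 2
  have h2 : (CFC.abs X + X).PosSemidef := by
    rw [← Matrix.nonneg_iff_posSemidef, CFC.abs_add_self X hsa]
    exact nsmul_nonneg (CFC.posPart_nonneg X) 2
  have h0 : (CFC.abs X).PosSemidef := Matrix.nonneg_iff_posSemidef.1 (CFC.abs_nonneg X)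
  -- Together these give |tr(MX)| ≤ tr(M|X|) ≤ tr|X|.
  have i1 := hM.re_trace_mul_nonneg h1
  have i2 := hM.re_trace_mul_nonneg h2
  have i3 := hM1.re_trace_mul_nonneg h0
  simp only [mul_sub, mul_add, sub_mul, one_mul, Matrix.trace_sub, Matrix.trace_add,
    Complex.sub_re, Complex.add_re] at i1 i2 i3
  rw [traceNorm, abs_le]
  constructor <;> linarith

/-- A positive functional is represented by a positive semidefinite matrix. -/
lemma exists_posSemidef_trace_mul (φ : Matrix N N ℂ →ₗ[ℂ] ℂ)
    (hφ : ∀ X : Matrix N N ℂ, X.PosSemidef → 0 ≤ φ X) :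
    ∃ B : Matrix N N ℂ, B.PosSemidef ∧ ∀ X, φ X = (B * X).trace := by
  have hsingle : ∀ (i j : N) (z : ℂ), φ (Matrix.single i j z) = z * φ (Matrix.single i j 1) :=
    fun i j z => by rw [← smul_eq_mul, ← map_smul, Matrix.smul_single, smul_eq_mul, mul_one]
  refine ⟨Matrix.of fun j i => φ (Matrix.single i j 1), ?_, fun X => ?_⟩
  -- The quadratic form of the representing matrix at v is φ evaluated at the positive matrix v v*.
  · have key : ∀ v : N → ℂ,
        star v ⬝ᵥ ((Matrix.of fun j i => φ (Matrix.single i j 1)) : Matrix N N ℂ).mulVec v =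
          φ (Matrix.vecMulVec v (star v)) := fun v => by
      conv_rhs => rw [Matrix.matrix_eq_sum_single (Matrix.vecMulVec v (star v))]
      simp only [map_sum, dotProduct, Matrix.mulVec, Matrix.of_apply, Finset.mul_sum]
      rw [Finset.sum_comm]
      refine Finset.sum_congr rfl fun i _ => Finset.sum_congr rfl fun j _ => ?_
      rw [hsingle i j (Matrix.vecMulVec v (star v) i j), Matrix.vecMulVec_apply, Pi.star_apply]
      ring
    rw [← Matrix.isPositive_toEuclideanLin_iff, LinearMap.isPositive_iff_complex]
    intro v
    have h := hφ _ (Matrix.posSemidef_vecMulVec_self_star v.ofLp)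
    rw [← key] at h
    rw [← inner_conj_symm, EuclideanSpace.inner_eq_star_dotProduct, Matrix.ofLp_toLpLin, Matrix.toLin'_apply,
      dotProduct_comm]
    obtain ⟨h1, h2⟩ := Complex.le_def.1 h
    exact ⟨Complex.ext (by simp) (by simpa using h2.symm), by simpa using h1⟩
  · conv_lhs => rw [Matrix.matrix_eq_sum_single X]
    simp only [map_sum, Matrix.trace, Matrix.diag, Matrix.mul_apply, Matrix.of_apply]
    rw [Finset.sum_comm]
    refine Finset.sum_congr rfl fun j _ => Finset.sum_congr rfl fun i _ => ?_
    rw [hsingle, mul_comm]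

end PosSemidef

/-! ### Channels in the Heisenberg picture -/

section Channel

variable {a b : Type} [Fintype a] [DecidableEq a] [Fintype b] [DecidableEq b]

lemma QuantumChannel.trace_lin (Φ : QuantumChannel a b) (X : Matrix a a ℂ) :
    (Φ.lin X).trace = X.trace := Φ.trace_map' X

lemma QuantumChannel.posSemidef_lin (Φ : QuantumChannel a b) {X : Matrix a a ℂ}
    (hX : X.PosSemidef) : (Φ.lin X).PosSemidef := by
  rw [← Matrix.nonneg_iff_posSemidef] at hX ⊢
  exact map_nonneg Φ.toCompletelyPositiveMap hX

/-- The effect `M` after the channel `Φ` is an effect before it. -/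
lemma QuantumChannel.exists_effect (Φ : QuantumChannel a b) {M : Matrix b b ℂ}
    (hM : M.PosSemidef) (hM1 : (1 - M).PosSemidef) :
    ∃ B : Matrix a a ℂ, B.PosSemidef ∧ (1 - B).PosSemidef ∧
      ∀ X, (M * Φ.lin X).trace = (B * X).trace := by
  have hnn : ∀ {P : Matrix b b ℂ}, P.PosSemidef → ∀ X : Matrix a a ℂ, X.PosSemidef →
      0 ≤ (P * Φ.lin X).trace := fun {P} hP X hX => by
    obtain ⟨L, hL⟩ := CStarAlgebra.nonneg_iff_eq_star_mul_self.1 hP.nonneg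
    rw [hL, Matrix.mul_assoc, Matrix.trace_mul_comm, Matrix.star_eq_conjTranspose]
    exact ((Φ.posSemidef_lin hX).mul_mul_conjTranspose_same L).trace_nonneg
  let φ : Matrix b b ℂ → Matrix a a ℂ →ₗ[ℂ] ℂ := fun P =>
    Matrix.traceLinearMap b ℂ ℂ ∘ₗ LinearMap.mulLeft ℂ P ∘ₗ Φ.lin
  obtain ⟨B, hB, hB'⟩ := exists_posSemidef_trace_mul (φ M) (hnn hM)
  obtain ⟨B₁, hB₁, hB₁'⟩ := exists_posSemidef_trace_mul (φ (1 - M)) (hnn hM1)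
  refine ⟨B, hB, ?_, hB'⟩
  -- Trace preservation: the representatives of M and 1 - M add up to 1.
  have : 1 - B = B₁ := by
    refine Matrix.ext_iff_trace_mul_right.2 fun X => ?_
    rw [← hB₁', sub_mul, one_mul, Matrix.trace_sub, ← hB']
    simp [φ, sub_mul, Φ.trace_lin]
  exact this ▸ hB₁

end Channel

/-! ### Erasure patterns, their Kraus operators and duals -/

section Pattern

variable {n : ℕ}

/-- The channel acting as the erasure pattern `s`. -/
noncomputable def patternMap (s : Fin n → Bool) :
    Matrix (Fin n → Qubit) (Fin n → Qubit) ℂ →ₗ[ℂ] Matrix (Fin n → QubitE) (Fin n → QubitE) ℂ :=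
  tensorMap fun i => erasureChannel (if s i then 1 else 0)

/-- The received basis vector when `i` is sent and the erasure pattern is `s`. -/
def kept (s : Fin n → Bool) (i : Fin n → Qubit) : Fin n → QubitE :=
  fun m => if s m then some (i m) else none

/-- The basis vector of the environment when `i` is sent and the erasure pattern is `s`. -/
def lost (s : Fin n → Bool) (i : Fin n → Qubit) : Fin n → QubitE :=
  fun m => if s m then none else some (i m)

/-- The Kraus operators of `patternMap s`. -/
def patternKraus (s : Fin n → Bool) (c : Fin n → QubitE) :
    Matrix (Fin n → QubitE) (Fin n → Qubit) ℂ :=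
  Matrix.of fun k i => if k = kept s i ∧ c = lost s i then 1 else 0

/-- Written as the indicator of one conjunction, so that a product over the qubits is again an
indicator. The last conjunct is the trace over the lost qubit. -/
lemma erasureChannel_single_apply (b : Bool) (x y : Qubit) (k l : QubitE) :
    erasureChannel (if b then 1 else 0) (Matrix.single x y 1) k l =
      if k = (if b then some x else none) ∧ l = (if b then some y else none) ∧
        (if b then none else some x) = (if b then none else some y) then 1 else 0 := by
  cases b <;> rcases k with _ | k <;> rcases l with _ | l <;>
    simp [erasureChannel, embedQubit, Matrix.single_apply, eq_comm, Matrix.trace]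
  fin_cases x <;> fin_cases y <;> simp

lemma patternMap_apply (s : Fin n → Bool) (X : Matrix (Fin n → Qubit) (Fin n → Qubit) ℂ) :
    patternMap s X = ∑ c, patternKraus s c * X * (patternKraus s c).conjTranspose := by
  ext k l
  simp only [patternMap, tensorMap, LinearMap.coe_mk, AddHom.coe_mk, Matrix.of_apply,
    erasureChannel_single_apply, Finset.prod_boole, Finset.mem_univ, true_implies, Matrix.sum_apply,
    Matrix.mul_apply, Matrix.conjTranspose_apply, Finset.sum_mul, patternKraus]
  rw [Finset.sum_comm]
  conv_rhs => rw [Finset.sum_comm]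
  refine Finset.sum_congr rfl fun j _ => ?_
  conv_rhs => rw [Finset.sum_comm]
  refine Finset.sum_congr rfl fun i _ => ?_
  rw [Finset.sum_eq_single (lost s i) (fun c _ hc => by simp [hc]) (by simp)]
  have : (∀ m, k m = (if s m then some (i m) else none) ∧ l m = (if s m then some (j m) else none) ∧
      (if s m then none else some (i m)) = (if s m then none else some (j m))) ↔
      k = kept s i ∧ l = kept s j ∧ lost s i = lost s j := by
    simp only [funext_iff, kept, lost, forall_and]
  rw [if_congr this rfl rfl]
  by_cases h1 : k = kept s i <;> by_cases h2 : l = kept s j <;>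
    by_cases h3 : lost s i = lost s j <;> simp [h1, h2, h3]

lemma posSemidef_patternMap (s : Fin n → Bool) {X : Matrix (Fin n → Qubit) (Fin n → Qubit) ℂ}
    (hX : X.PosSemidef) : (patternMap s X).PosSemidef := by
  rw [patternMap_apply]
  exact Matrix.posSemidef_sum _ fun c _ => hX.mul_mul_conjTranspose_same _

/-- The dual of `patternMap s`. -/
def patternDual (s : Fin n → Bool) (B : Matrix (Fin n → QubitE) (Fin n → QubitE) ℂ) :
    Matrix (Fin n → Qubit) (Fin n → Qubit) ℂ :=
  Matrix.of fun i j => if lost s i = lost s j then B (kept s i) (kept s j) else 0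

lemma patternDual_eq_sum (s : Fin n → Bool) (B : Matrix (Fin n → QubitE) (Fin n → QubitE) ℂ) :
    patternDual s B = ∑ c, (patternKraus s c).conjTranspose * B * patternKraus s c := by
  ext i j
  have h (c) : ((patternKraus s c).conjTranspose * B * patternKraus s c) i j =
      if c = lost s i then (if lost s i = lost s j then B (kept s i) (kept s j) else 0) else 0 := by
    simp only [Matrix.mul_apply, Matrix.conjTranspose_apply, patternKraus, Matrix.of_apply]
    rw [Finset.sum_eq_single (kept s j) (fun k _ hk => by simp [hk]) (by simp),
      Finset.sum_eq_single (kept s i) (fun k _ hk => by simp [hk]) (by simp)]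
    by_cases h1 : c = lost s i <;> by_cases h2 : lost s i = lost s j <;> simp [h1, h2]
    exact fun e e' => absurd e' e
  simp only [Matrix.sum_apply, h, Finset.sum_ite_eq', Finset.mem_univ, if_true]
  rfl

lemma posSemidef_patternDual (s : Fin n → Bool)
    {B : Matrix (Fin n → QubitE) (Fin n → QubitE) ℂ} (hB : B.PosSemidef) :
    (patternDual s B).PosSemidef := by
  rw [patternDual_eq_sum]
  exact Matrix.posSemidef_sum _ fun c _ => hB.conjTranspose_mul_mul_same _

lemma trace_mul_patternMap (s : Fin n → Bool) (B : Matrix (Fin n → QubitE) (Fin n → QubitE) ℂ)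
    (X : Matrix (Fin n → Qubit) (Fin n → Qubit) ℂ) :
    (B * patternMap s X).trace = (patternDual s B * X).trace := by
  rw [patternMap_apply, patternDual_eq_sum, Finset.mul_sum, Finset.sum_mul, Matrix.trace_sum,
    Matrix.trace_sum]
  refine Finset.sum_congr rfl fun c _ => ?_
  rw [← Matrix.mul_assoc, Matrix.trace_mul_comm]
  simp only [Matrix.mul_assoc]

lemma kept_eq_lost_eq {s : Fin n → Bool} {i j : Fin n → Qubit} (h1 : kept s i = kept s j)
    (h2 : lost s i = lost s j) : i = j := by
  funext m
  have e1 := congrFun h1 m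
  have e2 := congrFun h2 m
  cases h : s m <;> simp_all [kept, lost]

lemma patternDual_one (s : Fin n → Bool) : patternDual s 1 = 1 := by
  ext i j
  by_cases h : i = j
  · subst h
    simp [patternDual]
  · simp only [patternDual, Matrix.of_apply, Matrix.one_apply, h, if_false]
    split_ifs with h1 h2
    · exact absurd (kept_eq_lost_eq h2 h1) h
    · rfl
    · rfl

lemma patternDual_one_sub (s : Fin n → Bool) (B : Matrix (Fin n → QubitE) (Fin n → QubitE) ℂ) :
    patternDual s (1 - B) = 1 - patternDual s B := by
  rw [← patternDual_one s]
  ext i j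
  simp only [patternDual, Matrix.of_apply, Matrix.sub_apply]
  split_ifs <;> simp

lemma trace_patternMap (s : Fin n → Bool) (X : Matrix (Fin n → Qubit) (Fin n → Qubit) ℂ) :
    (patternMap s X).trace = X.trace := by
  simpa [patternDual_one] using trace_mul_patternMap s 1 X

/-- The resulting formula is symmetric under exchanging (s, B) with (t, C), which is what yields
commutation. -/
lemma patternDual_mul_apply {s t : Fin n → Bool} (hst : ∀ m, ¬(s m = true ∧ t m = true))
    (B C : Matrix (Fin n → QubitE) (Fin n → QubitE) ℂ) (i j : Fin n → Qubit) :
    (patternDual s B * patternDual t C) i j =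
      if ∀ m, s m = false → t m = false → i m = j m then
        B (kept s i) (kept s j) * C (kept t i) (kept t j) else 0 := by
  have hmem : ∀ m, s m = true → t m = false := fun m h => by
    simpa [h] using hst m
  simp only [Matrix.mul_apply, patternDual, Matrix.of_apply]
  -- The first factor forces the intermediate index to agree with i off s, the second forces it to
  -- agree with j off t, hence on s: at most one term survives.
  rw [Finset.sum_eq_single (fun m => if s m then j m else i m)]
  · have e1 : lost s i = lost s fun m => if s m then j m else i m := by
      funext m; simp only [lost]; split_ifs <;> rfl
    have e2 : kept s (fun m => if s m then j m else i m) = kept s j := by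
      funext m; simp only [kept]; split_ifs <;> rfl
    have e3 : kept t (fun m => if s m then j m else i m) = kept t i := by
      funext m
      have := hmem m
      cases h : s m <;> simp_all [kept]
    have e4 : (lost t (fun m => if s m then j m else i m) = lost t j) ↔
        ∀ m, s m = false → t m = false → i m = j m := by
      simp only [funext_iff, lost]
      refine forall_congr' fun m => ?_
      have := hmem m
      cases h : s m <;> cases h' : t m <;> simp_all
    rw [if_pos e1, e2, e3, if_congr e4 rfl rfl, mul_ite, mul_zero]
  · intro k _ hk
    by_contra hne
    refine hk (funext fun m => ?_)
    have h1 : lost s i = lost s k := by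
      by_contra h; simp [h] at hne
    have h2 : lost t k = lost t j := by
      by_contra h; simp [h] at hne
    have f1 := congrFun h1 m
    have f2 := congrFun h2 m
    have := hmem m
    cases h : s m <;> simp_all [lost]
  · simp

/-- Effects that are measured on disjoint sets of qubits commute. -/
lemma commute_patternDual {s t : Fin n → Bool} (hst : ∀ m, ¬(s m = true ∧ t m = true))
    (B C : Matrix (Fin n → QubitE) (Fin n → QubitE) ℂ) :
    Commute (patternDual s B) (patternDual t C) := by
  refine Matrix.ext fun i j => ?_
  rw [patternDual_mul_apply hst, patternDual_mul_apply fun m h => hst m h.symm, mul_comm]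
  refine if_congr (forall_congr' fun m => ?_) rfl rfl
  exact ⟨fun h a b => h b a, fun h a b => h b a⟩

/-- Each factor is a mixture of perfect transmission and certain erasure; expanding the product of
sums gives one term per pattern. -/
lemma tensorMap_erasureChannel (p : ℝ) (X : Matrix (Fin n → Qubit) (Fin n → Qubit) ℂ) :
    tensorMap (fun _ => erasureChannel p) X =
      ∑ s : Fin n → Bool, (patternProb p s : ℂ) • patternMap s X := by
  have h1 : ∀ (x : Matrix Qubit Qubit ℂ) (k l : QubitE), erasureChannel p x k l =
      ∑ b : Bool, ((if b then p else 1 - p : ℝ) : ℂ) *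
        erasureChannel (if b then 1 else 0) x k l := fun x k l => by
    rcases k with _ | k <;> rcases l with _ | l <;> simp [erasureChannel]
  ext k l
  simp only [Matrix.sum_apply, Matrix.smul_apply, patternMap, tensorMap, LinearMap.coe_mk,
    AddHom.coe_mk, Matrix.of_apply, smul_eq_mul, Finset.mul_sum]
  conv_rhs => rw [Finset.sum_comm]
  refine Finset.sum_congr rfl fun i _ => ?_
  conv_rhs => rw [Finset.sum_comm]
  refine Finset.sum_congr rfl fun j _ => ?_
  simp_rw [h1 (Matrix.single _ _ _), Finset.prod_univ_sum, Fintype.piFinset_univ, Finset.mul_sum,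
    Finset.prod_mul_distrib, patternProb, Complex.ofReal_prod]
  exact Finset.sum_congr rfl fun s _ => by ring

end Pattern

/-! ### Conjugate bases and commuting measurements -/

section NoCloning

/-- The projections onto the two elements of the computational basis. -/
def projZ (b : Bool) : Matrix Qubit Qubit ℂ := if b then !![1, 0; 0, 0] else !![0, 0; 0, 1]

/-- The projections onto the two elements of the Hadamard basis. -/
noncomputable def projX (b : Bool) : Matrix Qubit Qubit ℂ :=
  if b then !![1 / 2, 1 / 2; 1 / 2, 1 / 2] else !![1 / 2, -1 / 2; -1 / 2, 1 / 2]

lemma projZ_true_add_false : projZ true + projZ false = 1 := by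
  ext i j
  fin_cases i <;> fin_cases j <;> simp [projZ]

lemma projX_true_add_false : projX true + projX false = 1 := by
  ext i j
  fin_cases i <;> fin_cases j <;> norm_num [projX]

lemma posSemidef_projZ (b : Bool) : (projZ b).PosSemidef := by
  have : projZ b = Matrix.vecMulVec (if b then ![1, 0] else ![0, 1])
      (star (if b then ![1, 0] else ![0, 1])) := by
    ext i j
    cases b <;> fin_cases i <;> fin_cases j <;> simp [projZ, Matrix.vecMulVec_apply]
  rw [this]
  exact Matrix.posSemidef_vecMulVec_self_star _

lemma posSemidef_projX (b : Bool) : (projX b).PosSemidef := by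
  have : projX b = (1 / 2 : ℝ) • Matrix.vecMulVec (if b then ![1, 1] else ![1, -1])
      (star (if b then ![1, 1] else ![1, -1])) := by
    ext i j
    simp only [Matrix.smul_apply, Matrix.vecMulVec_apply, Pi.star_apply]
    cases b <;> fin_cases i <;> fin_cases j <;> norm_num [projX]
  rw [this]
  exact (Matrix.posSemidef_vecMulVec_self_star _).smul (by norm_num)

lemma isDensityMatrix_projZ (b : Bool) : IsDensityMatrix (projZ b) :=
  ⟨posSemidef_projZ b, by cases b <;> simp [projZ, Matrix.trace_fin_two]⟩

lemma isDensityMatrix_projX (b : Bool) : IsDensityMatrix (projX b) :=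
  ⟨posSemidef_projX b, by cases b <;> norm_num [projX, Matrix.trace_fin_two]⟩

/-- The least eigenvalue of the sum of two such projections is 1 - 1/√2 > 1/4. Quantitatively, no
state is nearly orthogonal to both a Z and an X eigenstate. -/
lemma posSemidef_proj_add_proj_sub_one (a b : Bool) :
    ((4 : ℝ) • (projZ a + projX b) - 1).PosSemidef := by
  have : (4 : ℝ) • (projZ a + projX b) - 1 = projZ a +
      Matrix.vecMulVec (if a then ![2, if b then 1 else -1] else ![1, if b then 2 else -2])
        (star (if a then ![2, if b then 1 else -1] else ![1, if b then 2 else -2])) := by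
    ext i j
    simp only [Matrix.add_apply, Matrix.sub_apply, Matrix.smul_apply, Matrix.vecMulVec_apply,
      Pi.star_apply]
    cases a <;> cases b <;> fin_cases i <;> fin_cases j <;> norm_num [projX, projZ]
  rw [this]
  exact (posSemidef_projZ a).add (Matrix.posSemidef_vecMulVec_self_star _)

variable {N : Type} [Fintype N] [DecidableEq N]

/-- The information about a qubit in both of two conjugate bases is not accessible to commuting
measurements. -/
theorem half_le_error_of_commute (E : QuantumChannel Qubit N) {A B : Matrix N N ℂ}
    (hA : A.PosSemidef) (hA1 : (1 - A).PosSemidef) (hB : B.PosSemidef) (hB1 : (1 - B).PosSemidef)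
    (hAB : Commute A B) :
    1 / 2 ≤ ((1 - A) * E.lin (projZ true)).trace.re + (A * E.lin (projZ false)).trace.re +
      ((1 - B) * E.lin (projX true)).trace.re + (B * E.lin (projX false)).trace.re := by
  -- Products of commuting effects are effects, so A, B and their complements form a joint
  -- four-outcome measurement. Each outcome is paired with the two states for which it is wrong;
  -- summing over outcomes gives 2 = tr E(1) ≤ 4 · (total error).
  have key : ∀ (a b : Bool) {P Q : Matrix N N ℂ}, P.PosSemidef → Q.PosSemidef → Commute P Q →
      (P * Q * E.lin 1).trace.re ≤ 4 * ((P * Q * E.lin (projZ a)).trace.re +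
        (P * Q * E.lin (projX b)).trace.re) := fun a b P Q hP hQ hPQ => by
    have h1 : (P * Q).PosSemidef :=
      Matrix.nonneg_iff_posSemidef.1 (hPQ.mul_nonneg hP.nonneg hQ.nonneg)
    have h2 := h1.re_trace_mul_nonneg (E.posSemidef_lin (posSemidef_proj_add_proj_sub_one a b))
    have e : ((4 : ℝ) • (projZ a + projX b) - 1) = ((4 : ℂ) • (projZ a + projX b) - 1) := by
      ext i j; simp
    rw [e, map_sub, map_smul, map_add] at h2
    simp only [mul_sub, mul_add, Matrix.mul_smul, Matrix.trace_sub, Matrix.trace_add,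
      Matrix.trace_smul, Complex.sub_re, smul_eq_mul] at h2
    simp at h2
    linarith
  have hA1B : Commute (1 - A) B := (Commute.one_left B).sub_left hAB
  have hAB1 : Commute A (1 - B) := (Commute.one_right A).sub_right hAB
  have hA1B1 : Commute (1 - A) (1 - B) := (Commute.one_right _).sub_right hA1B
  have k1 := key false false hA hB hAB
  have k2 := key false true hA hB1 hAB1
  have k3 := key true false hA1 hB hA1B
  have k4 := key true true hA1 hB1 hA1B1
  have ht : (E.lin 1).trace.re = 2 := by rw [E.trace_lin]; simp
  simp only [sub_mul, mul_sub, one_mul, mul_one, Matrix.trace_sub, Complex.sub_re] at *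
  linarith

end NoCloning

/-! ### Decoding errors and the bound on q -/

section Decoder

/-- The isometry that embeds the qubit into the output space of the erasure channel. -/
def embedIsometry : Matrix QubitE Qubit ℂ := Matrix.of fun k i => if k = some i then 1 else 0

lemma embedQubit_eq (X : Matrix Qubit Qubit ℂ) :
    embedQubit X = embedIsometry * X * embedIsometry.conjTranspose := by
  ext (_ | k) (_ | l) <;> simp [embedQubit, embedIsometry, Matrix.mul_apply]

lemma posSemidef_embedQubit {X : Matrix Qubit Qubit ℂ} (hX : X.PosSemidef) :
    (embedQubit X).PosSemidef := by
  rw [embedQubit_eq]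
  exact hX.mul_mul_conjTranspose_same _

/-- The projection onto the erasure flag. -/
def erasedProj : Matrix QubitE QubitE ℂ := Matrix.single none none 1

lemma posSemidef_erasedProj : erasedProj.PosSemidef := by
  have : erasedProj = Matrix.vecMulVec (Pi.single none 1) (star (Pi.single none 1)) := by
    ext (_ | i) (_ | j) <;> simp [erasedProj, Matrix.vecMulVec_apply]
  rw [this]
  exact Matrix.posSemidef_vecMulVec_self_star _

lemma trace_erasedProj_mul (Y : Matrix QubitE QubitE ℂ) :
    (erasedProj * Y).trace = Y none none := by
  simp [erasedProj, Matrix.trace, Matrix.single_mul_apply_same, Fintype.sum_option]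

lemma one_sub_embedQubit (X : Matrix Qubit Qubit ℂ) :
    1 - embedQubit X = embedQubit (1 - X) + erasedProj := by
  ext (_ | k) (_ | l) <;> simp [embedQubit, erasedProj, Matrix.one_apply]

lemma posSemidef_one_sub_embedQubit {X : Matrix Qubit Qubit ℂ} (hX : (1 - X).PosSemidef) :
    (1 - embedQubit X).PosSemidef := by
  rw [one_sub_embedQubit]
  exact (posSemidef_embedQubit hX).add posSemidef_erasedProj

lemma posSemidef_one_sub_erasedProj : (1 - erasedProj).PosSemidef := by
  have h := one_sub_embedQubit 1
  rw [sub_self] at h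
  have h0 : embedQubit 0 = 0 := by ext (_ | k) (_ | l) <;> rfl
  rw [h0, zero_add] at h
  rw [← h, sub_sub_cancel]
  exact posSemidef_embedQubit Matrix.PosSemidef.one

lemma trace_embedQubit_mul_erasureChannel (q : ℝ) (X Y : Matrix Qubit Qubit ℂ) :
    (embedQubit X * erasureChannel q Y).trace = q * (X * Y).trace := by
  simp [Matrix.trace, Matrix.mul_apply, Fintype.sum_option, embedQubit, erasureChannel]
  ring

variable {n : ℕ}

/-- The probability that the projection `P` accepts the output of the decoder, if the state `Q` is
sent and the erasure pattern is `s`. -/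
noncomputable def acceptProb (E : QuantumChannel Qubit (Fin n → Qubit))
    (D : QuantumChannel (Fin n → QubitE) QubitE) (P Q : Matrix Qubit Qubit ℂ)
    (s : Fin n → Bool) : ℝ :=
  (embedQubit P * D.lin (patternMap s (E.lin Q))).trace.re

variable {E : QuantumChannel Qubit (Fin n → Qubit)} {D : QuantumChannel (Fin n → QubitE) QubitE}

lemma acceptProb_nonneg {P Q : Matrix Qubit Qubit ℂ} (hP : P.PosSemidef) (hQ : Q.PosSemidef)
    (s : Fin n → Bool) : 0 ≤ acceptProb E D P Q s :=
  (posSemidef_embedQubit hP).re_trace_mul_nonneg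
    (D.posSemidef_lin (posSemidef_patternMap s (E.posSemidef_lin hQ)))

lemma acceptProb_le_one {P Q : Matrix Qubit Qubit ℂ} (hP : (1 - P).PosSemidef)
    (hQ : IsDensityMatrix Q) (s : Fin n → Bool) : acceptProb E D P Q s ≤ 1 := by
  have h := (posSemidef_one_sub_embedQubit hP).re_trace_mul_nonneg
    (D.posSemidef_lin (posSemidef_patternMap s (E.posSemidef_lin hQ.1)))
  rw [sub_mul, one_mul, Matrix.trace_sub, Complex.sub_re, D.trace_lin, trace_patternMap,
    E.trace_lin, hQ.2] at h
  rw [acceptProb]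
  simpa using h

/-- The receivers of disjoint sets of qubits cannot both decode. -/
theorem half_le_error_of_disjoint (E : QuantumChannel Qubit (Fin n → Qubit))
    (D : QuantumChannel (Fin n → QubitE) QubitE) {s t : Fin n → Bool}
    (hst : ∀ m, ¬(s m = true ∧ t m = true)) :
    1 / 2 ≤ (1 - acceptProb E D (projZ true) (projZ true) s +
        acceptProb E D (projZ true) (projZ false) s) +
      (1 - acceptProb E D (projX true) (projX true) t +
        acceptProb E D (projX true) (projX false) t) := by
  have hZ : (1 - projZ true).PosSemidef := by
    rw [← projZ_true_add_false, add_sub_cancel_left]; exact posSemidef_projZ _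
  have hX : (1 - projX true).PosSemidef := by
    rw [← projX_true_add_false, add_sub_cancel_left]; exact posSemidef_projX _
  obtain ⟨B, hB, hB1, hB'⟩ := D.exists_effect (posSemidef_embedQubit (posSemidef_projZ true))
    (posSemidef_one_sub_embedQubit hZ)
  obtain ⟨C, hC, hC1, hC'⟩ := D.exists_effect (posSemidef_embedQubit (posSemidef_projX true))
    (posSemidef_one_sub_embedQubit hX)
  have h := half_le_error_of_commute E (posSemidef_patternDual s hB)
    (patternDual_one_sub s B ▸ posSemidef_patternDual s hB1) (posSemidef_patternDual t hC)
    (patternDual_one_sub t C ▸ posSemidef_patternDual t hC1) (commute_patternDual hst B C)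
  simp only [sub_mul, one_mul, Matrix.trace_sub, Complex.sub_re, E.trace_lin,
    (isDensityMatrix_projZ _).2, (isDensityMatrix_projX _).2, Complex.one_re] at h
  simp only [acceptProb, hB', hC', trace_mul_patternMap]
  linarith

/-- Nothing is accepted if the decoder outputs an erasure. -/
lemma acceptProb_nonpos {P Q : Matrix Qubit Qubit ℂ} (hP : P.PosSemidef) (hP1 : (1 - P).PosSemidef)
    (hQ : (1 - Q).PosSemidef) {s : Fin n → Bool} (hs : nonErasureProb E D s = 0) :
    acceptProb E D P Q s ≤ 0 := by
  set Y := D.lin (patternMap s (E.lin 1)) with hY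
  -- From Q ≤ 1 and P ≤ 1, the acceptance probability is at most the weight of Y off the flag, which
  -- is 2 - Y_EE = 2F(s) = 0.
  have h1 := (posSemidef_embedQubit hP).re_trace_mul_nonneg
    (D.posSemidef_lin (posSemidef_patternMap s (E.posSemidef_lin hQ)))
  simp only [map_sub, mul_sub, Matrix.trace_sub, Complex.sub_re] at h1
  have h2 := (posSemidef_embedQubit hP1).re_trace_mul_nonneg
    (D.posSemidef_lin (posSemidef_patternMap s (E.posSemidef_lin Matrix.PosSemidef.one)))
  have h3 : embedQubit (1 - P) = 1 - embedQubit P - erasedProj := by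
    rw [one_sub_embedQubit, add_sub_cancel_right]
  have h4 : nonErasureProb E D s = 1 - (Y none none).re / 2 := by
    have : patternState E s = (1 / 2 : ℂ) • patternMap s (E.lin 1) := by
      rw [← map_smul, ← map_smul]; rfl
    rw [nonErasureProb, this, map_smul, Matrix.smul_apply, smul_eq_mul, hY]
    simp
    ring
  have h5 : Y.trace.re = 2 := by
    rw [hY, D.trace_lin, trace_patternMap, E.trace_lin]; simp
  rw [h3, ← hY] at h2
  simp only [sub_mul, one_mul, Matrix.trace_sub, Complex.sub_re, trace_erasedProj_mul, h5] at h2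
  rw [acceptProb]
  linarith

lemma posSemidef_erasureChannel {q : ℝ} (hq0 : 0 ≤ q) (hq1 : q ≤ 1) {ρ : Matrix Qubit Qubit ℂ}
    (hρ : IsDensityMatrix ρ) : (erasureChannel q ρ).PosSemidef := by
  have e : erasureChannel q ρ = (q : ℂ) • embedQubit ρ + ((1 - q : ℝ) : ℂ) • erasedProj := by
    simp [erasureChannel, erasedProj, hρ.2]
  rw [e]
  exact ((posSemidef_embedQubit hρ.1).smul (Complex.zero_le_real.2 hq0)).add
    (posSemidef_erasedProj.smul (Complex.zero_le_real.2 (sub_nonneg.2 hq1)))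

/-- In an `ε`-simulation, the average over the erasure patterns of the probability of an effect
differs by at most `ε` from its probability after the simulated channel. -/
lemma abs_average_sub_le {p q ε : ℝ} (hp0 : 0 ≤ p) (hp1 : p ≤ 1) (hq0 : 0 ≤ q) (hq1 : q ≤ 1)
    (hsim : IsSimulation ε (erasureChannel p) (erasureChannel q) n E D)
    {M : Matrix QubitE QubitE ℂ} (hM : M.PosSemidef) (hM1 : (1 - M).PosSemidef)
    {ρ : Matrix Qubit Qubit ℂ} (hρ : IsDensityMatrix ρ) :
    |∑ s, patternProb p s * (M * D.lin (patternMap s (E.lin ρ))).trace.re -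
      (M * erasureChannel q ρ).trace.re| ≤ ε := by
  have h := hsim ρ hρ
  rw [tensorMap_erasureChannel, map_sum] at h
  simp only [map_smul] at h
  refine le_trans ?_ ((abs_re_trace_mul_le_traceNorm hM hM1 ?_).trans h)
  · rw [mul_sub, Finset.mul_sum, Matrix.trace_sub, Matrix.trace_sum, Complex.sub_re,
      Complex.re_sum]
    simp [Matrix.trace_smul]
  · refine Matrix.IsHermitian.sub (Matrix.PosSemidef.isHermitian ?_)
      (posSemidef_erasureChannel hq0 hq1 hρ).isHermitian
    exact Matrix.posSemidef_sum _ fun s _ =>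
      (D.posSemidef_lin (posSemidef_patternMap s (E.posSemidef_lin hρ.1))).smul
        (Complex.zero_le_real.2 (patternProb_nonneg hp0 hp1 s))

/-- The average decoding error, over the patterns that a deterministic decoder accepts, in one of
the two bases. -/
lemma sum_error_le {p q ε : ℝ} (hp0 : 0 ≤ p) (hp1 : p ≤ 1) (hq0 : 0 ≤ q) (hq1 : q ≤ 1)
    (hsim : IsSimulation ε (erasureChannel p) (erasureChannel q) n E D)
    {P Q : Matrix Qubit Qubit ℂ} (hP : IsDensityMatrix P) (hQ : IsDensityMatrix Q)
    (hPQ : P + Q = 1) (hPP : P * P = P) (S : Finset (Fin n → Bool))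
    (hS : ∀ s ∉ S, nonErasureProb E D s = 0) (hSq : ∑ s ∈ S, patternProb p s ≤ q + ε) :
    ∑ s ∈ S, patternProb p s * (1 - acceptProb E D P P s + acceptProb E D P Q s) ≤ 3 * ε := by
  have hP1 : (1 - P).PosSemidef := by rw [← hPQ, add_sub_cancel_left]; exact hQ.1
  have h1 := abs_average_sub_le hp0 hp1 hq0 hq1 hsim (posSemidef_embedQubit hP.1)
    (posSemidef_one_sub_embedQubit hP1) hP
  have h2 := abs_average_sub_le hp0 hp1 hq0 hq1 hsim (posSemidef_embedQubit hP.1)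
    (posSemidef_one_sub_embedQubit hP1) hQ
  have hPQ0 : P * Q = 0 := by rw [← add_sub_cancel_left P Q, hPQ, mul_sub, mul_one, hPP, sub_self]
  rw [trace_embedQubit_mul_erasureChannel, hPP, hP.2, abs_le] at h1
  rw [trace_embedQubit_mul_erasureChannel, hPQ0, abs_le] at h2
  simp only [mul_one, Complex.ofReal_re, Matrix.trace_zero, mul_zero, Complex.zero_re,
    sub_zero] at h1 h2
  -- Patterns outside S contribute nothing positive, so the average over all patterns is already
  -- attained on S.
  have e1 : ∑ s, patternProb p s * acceptProb E D P P s ≤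
      ∑ s ∈ S, patternProb p s * acceptProb E D P P s := by
    rw [← Finset.sum_sdiff (Finset.subset_univ S)]
    refine add_le_of_nonpos_left (Finset.sum_nonpos fun s hs => ?_)
    exact mul_nonpos_of_nonneg_of_nonpos (patternProb_nonneg hp0 hp1 s)
      (acceptProb_nonpos hP.1 hP1 hP1 (hS s (Finset.mem_sdiff.1 hs).2))
  have e2 : ∑ s ∈ S, patternProb p s * acceptProb E D P Q s ≤
      ∑ s, patternProb p s * acceptProb E D P Q s :=
    Finset.sum_le_sum_of_subset_of_nonneg (Finset.subset_univ _) fun s _ _ =>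
      mul_nonneg (patternProb_nonneg hp0 hp1 s) (acceptProb_nonneg hP.1 hQ.1 s)
  simp only [mul_add, mul_sub, mul_one, Finset.sum_add_distrib, Finset.sum_sub_distrib]
  simp only [acceptProb] at e1 e2 ⊢
  -- One ε each from the mass of S, the acceptance of P and the false acceptance of Q.
  linarith [h1.1, h2.2]

/-- Simulation with a deterministic decoder increases the transmission probability by at most a
multiple of the error. -/
theorem transmission_le_of_isSimulation {p q ε : ℝ} (hp0 : 0 ≤ p) (hp : p ≤ 1 / 2) (hq0 : 0 ≤ q)
    (hq1 : q ≤ 1) (hdet : IsDeterministicDecoder E D)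
    (hsim : IsSimulation ε (erasureChannel p) (erasureChannel q) n E D) : q ≤ p + 25 * ε := by
  classical
  have hp1 : p ≤ 1 := by linarith
  set S : Finset (Fin n → Bool) := {s | nonErasureProb E D s = 1} with hSdef
  have hS : ∀ s ∉ S, nonErasureProb E D s = 0 := fun s hs =>
    (hdet s).resolve_right fun h => hs (by simp [hSdef, h])
  have hmass : |∑ s ∈ S, patternProb p s - q| ≤ ε := by
    have hρ : IsDensityMatrix ((1 / 2 : ℂ) • (1 : Matrix Qubit Qubit ℂ)) :=
      ⟨Matrix.PosSemidef.one.smul (by norm_num [Complex.le_def]), by simp [Matrix.trace_smul]⟩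
    have h := abs_average_sub_le hp0 hp1 hq0 hq1 hsim posSemidef_erasedProj
      posSemidef_one_sub_erasedProj hρ
    simp only [trace_erasedProj_mul] at h
    have e1 : (erasureChannel q ((1 / 2 : ℂ) • 1) none none).re = 1 - q := by
      simp [erasureChannel, embedQubit]
      ring
    have e2 : ∀ s, (D.lin (patternMap s (E.lin ((1 / 2 : ℂ) • 1))) none none).re =
        1 - if s ∈ S then 1 else 0 := fun s => by
      have : (D.lin (patternMap s (E.lin ((1 / 2 : ℂ) • 1))) none none).re =
        1 - nonErasureProb E D s := (sub_sub_cancel _ _).symm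
      rw [this]
      split_ifs with hs
      · rw [(Finset.mem_filter.1 hs).2]
      · rw [hS s hs]
    have e3 : ∑ s : Fin n → Bool, patternProb p s = 1 := by
      have := Finset.prod_univ_sum (fun _ : Fin n => (Finset.univ : Finset Bool))
        (fun _ b => if b then p else 1 - p)
      rw [Fintype.piFinset_univ] at this
      simpa [patternProb] using this.symm
    simp only [e2, mul_sub, mul_one, mul_ite, mul_zero, Finset.sum_sub_distrib, e1, e3,
      Finset.sum_ite_mem, Finset.univ_inter] at h
    rwa [abs_sub_comm, show q - ∑ s ∈ S, patternProb p s =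
      1 - ∑ s ∈ S, patternProb p s - (1 - q) by ring]
  rw [abs_le] at hmass
  set eZ : (Fin n → Bool) → ℝ := fun s =>
    1 - acceptProb E D (projZ true) (projZ true) s + acceptProb E D (projZ true) (projZ false) s
    with heZ
  set eX : (Fin n → Bool) → ℝ := fun s =>
    1 - acceptProb E D (projX true) (projX true) s + acceptProb E D (projX true) (projX false) s
    with heX
  have hZ1 : (1 - projZ true).PosSemidef := by
    rw [← projZ_true_add_false, add_sub_cancel_left]; exact posSemidef_projZ _
  have hX1 : (1 - projX true).PosSemidef := by
    rw [← projX_true_add_false, add_sub_cancel_left]; exact posSemidef_projX _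
  have hZ : ∑ s ∈ S, patternProb p s * eZ s ≤ 3 * ε :=
    sum_error_le hp0 hp1 hq0 hq1 hsim (isDensityMatrix_projZ _) (isDensityMatrix_projZ _)
      projZ_true_add_false (by ext i j; fin_cases i <;> fin_cases j <;> simp [projZ]) S hS
      (by linarith [hmass.2])
  have hX : ∑ s ∈ S, patternProb p s * eX s ≤ 3 * ε :=
    sum_error_le hp0 hp1 hq0 hq1 hsim (isDensityMatrix_projX _) (isDensityMatrix_projX _)
      projX_true_add_false (by ext i j; fin_cases i <;> fin_cases j <;> norm_num [projX]) S hS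
      (by linarith [hmass.2])
  have heZ0 : ∀ s, 0 ≤ eZ s := fun s => add_nonneg
    (sub_nonneg.2 (acceptProb_le_one hZ1 (isDensityMatrix_projZ _) s))
    (acceptProb_nonneg (posSemidef_projZ _) (posSemidef_projZ _) s)
  have heX0 : ∀ s, 0 ≤ eX s := fun s => add_nonneg
    (sub_nonneg.2 (acceptProb_le_one hX1 (isDensityMatrix_projX _) s))
    (acceptProb_nonneg (posSemidef_projX _) (posSemidef_projX _) s)
  -- The threshold 1/4 is half of the no-cloning bound: two disjoint good patterns would give eZ s +
  -- eX t < 1/2.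
  have hgood := sum_patternProb_le_of_intersecting hp0 hp {s ∈ S | eZ s + eX s < 1 / 4}
    fun s hs t ht => by
      by_contra! hcon
      have h1 := half_le_error_of_disjoint E D (s := s) (t := t) fun m hm => hcon m hm.1 hm.2
      have h2 := (Finset.mem_filter.1 hs).2
      have h3 := (Finset.mem_filter.1 ht).2
      linarith [heX0 s, heZ0 t]
  -- Markov's inequality: a pattern with error at least 1/4 weighs at most four times its
  -- contribution to the average error.
  have hsum : ∑ s ∈ S, patternProb p s ≤
      ∑ s ∈ S with eZ s + eX s < 1 / 4, patternProb p s +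
        ∑ s ∈ S, 4 * (patternProb p s * eZ s + patternProb p s * eX s) := by
    rw [Finset.sum_filter (s := S), ← Finset.sum_add_distrib]
    refine Finset.sum_le_sum fun s _ => ?_
    have h0 := patternProb_nonneg hp0 hp1 s
    split_ifs with h
    · nlinarith [heZ0 s, heX0 s, mul_nonneg h0 (heZ0 s), mul_nonneg h0 (heX0 s)]
    · nlinarith
  rw [← Finset.mul_sum, Finset.sum_add_distrib] at hsum
  -- q - ε ≤ p + 4(3ε + 3ε), whence the constant 25.
  linarith [hmass.1]

end Decoder

theorem mainTheorem2 (p q : ℝ) (hp0 : 0 ≤ p) (hp : p ≤ 1 / 2) (hpq : p < q) (hq1 : q ≤ 1) :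
    ¬ ∀ ε : ℝ, 0 < ε →
      ∃ (n : ℕ) (E : QuantumChannel Qubit (Fin n → Qubit))
        (D : QuantumChannel (Fin n → QubitE) QubitE),
        IsDeterministicDecoder E D ∧
          IsSimulation ε (erasureChannel p) (erasureChannel q) n E D := by
  intro h
  -- With this ε, 25ε is half of the gap q - p.
  obtain ⟨n, E, D, hdet, hsim⟩ := h ((q - p) / 50) (by linarith)
  have := transmission_le_of_isSimulation hp0 hp (hp0.trans hpq.le) hq1 hdet hsim
  linarith
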